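/- A \emph{monotonic counter machine} is a tuple $\mathcal{C}=\langle S,C,\Delta\rangle$, where $S$ is a finite set of states, $C=\{c_1,\dots,c_n\}$ is a finite set of counters, and $\Delta\subseteq S\times\Phi(C)\times \mathrm{Op}(C)\times S$ is a finite set of edges. Here the guards $\Phi(C)$ are given by $\varphi ::= \mathrm{true}\mid c<k\mid c=k\mid c>k\mid \varphi\wedge\varphi$ with $c\in C$, $k\in\mathbb{Z}$, and the operations are $\mathrm{Op}(C)=\{\mathit{reset}(c),\mathit{inc}(c): c\in C\}\cup\{\mathit{nop}\}$. Configurations are pairs $\langle s,\upsilon\rangle\in S\times\mathbb{N}^n$. There is a transition $\langle s,\upsilon\rangle\to\langle s',\upsilon'\rangle$ if some edge $\langle s,\varphi,\mathit{op},s'\rangle\in\Delta$ satisfies $\upsilon\models\varphi$ and $\upsilon'$ is obtained from $\upsilon$ by performing $\mathit{op}$: set counter $c_i$ to $0$ for $\mathit{reset}(c_i)$, add $1$ to $c_i$ for $\mathit{inc}(c_i)$, change nothing for $\mathit{nop}$. Let $\to^*$ be the reflexive transitive closure of $\to$. Presburger arithmetic is the first-order language interpreted over $\mathbb{Z}$ with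 terms $t::=c\mid z\mid t+t\mid t-t$ ($c\in\mathbb{Z}$, $z$ a variable) and atomic formulas $t\le t'$ and $t\equiv t'\pmod m$ ($m\in\mathbb{Z}$). Its existential fragment consists of the formulas $\exists z_1\cdots\exists z_k\,\psi$ with $\psi$ quantifier-free. The size $|\mathcal{C}|$ is the number of counters plus the number of states plus the total length of all edges; the size of a formula is its length. Integer constants are written in binary in both. \textbf{Proposition.} There is a polynomial $p$ such that for every $n\ge 0$, every monotonic counter machine $\mathcal{C}$ with $n$ counters, and all states $s,s'$ of $\mathcal{C}$, the reachability relation \[ \{\langle\upsilon,\upsilon'\rangle\in\mathbb{N}^{2n} : \langle s,\upsilon\rangle\to^*\langle s',\upsilon'\rangle\} \] is defined, as a subset of $\mathbb{Z}^{2n}$, by a formula with $2n$ free variables in the existential fragment of Presburger arithmetic, of size at most $2^{p(|\mathcal{C}|)}$. -/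

import Mathlib

/-! ### Presburger arithmetic over the integers -/

namespace PresburgerZ

/-- Number of bits used to write an integer in binary (a sign bit and the binary digits). -/
def intBits (k : ℤ) : ℕ := 1 + Nat.size k.natAbs

/-- Terms `t ::= c | z | t + t | t - t` of integer sort, with `c ∈ ℤ` and with variables among
`z_0, …, z_{k-1}`. -/
inductive Term (k : ℕ) : Type
  | const (c : ℤ) : Term k
  | var (i : Fin k) : Term k
  | add (t u : Term k) : Term k
  | sub (t u : Term k) : Term k

/-- The value of a term in `ℤ`. -/
def Term.eval {k : ℕ} (x : Fin k → ℤ) : Term k → ℤ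
  | .const c => c
  | .var i => x i
  | .add t u => t.eval x + u.eval x
  | .sub t u => t.eval x - u.eval x

/-- The length of a term; constants and indices of variables are written in binary. -/
def Term.size {k : ℕ} : Term k → ℕ
  | .const c => intBits c
  | .var i => 1 + Nat.size i
  | .add t u => 1 + t.size + u.size
  | .sub t u => 1 + t.size + u.size

/-- Formulas of Presburger arithmetic with free variables among `z_0, …, z_{k-1}`. The atomic
formulas are `t ≤ u` and `t ≡ u (mod m)`. A quantifier binds the variable with the next free
index `k`. -/
inductive Formula : ℕ → Type
  | le {k : ℕ} (t u : Term k) : Formula k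
  | modEq {k : ℕ} (m : ℤ) (t u : Term k) : Formula k
  | not {k : ℕ} (φ : Formula k) : Formula k
  | and {k : ℕ} (φ ψ : Formula k) : Formula k
  | or {k : ℕ} (φ ψ : Formula k) : Formula k
  | ex {k : ℕ} (φ : Formula (k + 1)) : Formula k
  | all {k : ℕ} (φ : Formula (k + 1)) : Formula k

/-- Satisfaction in the structure `ℤ`. -/
def Formula.Holds : {k : ℕ} → Formula k → (Fin k → ℤ) → Prop
  | _, .le t u, x => t.eval x ≤ u.eval x
  | _, .modEq m t u, x => t.eval x ≡ u.eval x [ZMOD m]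
  | _, .not φ, x => ¬ φ.Holds x
  | _, .and φ ψ, x => φ.Holds x ∧ ψ.Holds x
  | _, .or φ ψ, x => φ.Holds x ∨ ψ.Holds x
  | _, .ex φ, x => ∃ a : ℤ, φ.Holds (Fin.snoc x a)
  | _, .all φ, x => ∀ a : ℤ, φ.Holds (Fin.snoc x a)

/-- The length of a formula; integers and indices of variables are written in binary. -/
def Formula.size : {k : ℕ} → Formula k → ℕ
  | _, .le t u => 1 + t.size + u.size
  | _, .modEq m t u => 1 + intBits m + t.size + u.size
  | _, .not φ => 1 + φ.size
  | _, .and φ ψ => 1 + φ.size + ψ.size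
  | _, .or φ ψ => 1 + φ.size + ψ.size
  | k, .ex φ => 2 + Nat.size k + φ.size
  | k, .all φ => 2 + Nat.size k + φ.size

/-- Quantifier-free formulas. -/
inductive Formula.IsQF : {k : ℕ} → Formula k → Prop
  | le {k : ℕ} (t u : Term k) : IsQF (Formula.le t u)
  | modEq {k : ℕ} (m : ℤ) (t u : Term k) : IsQF (Formula.modEq m t u)
  | not {k : ℕ} {φ : Formula k} : IsQF φ → IsQF (Formula.not φ)
  | and {k : ℕ} {φ ψ : Formula k} : IsQF φ → IsQF ψ → IsQF (Formula.and φ ψ)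
  | or {k : ℕ} {φ ψ : Formula k} : IsQF φ → IsQF ψ → IsQF (Formula.or φ ψ)

/-- The existential fragment: formulas `∃ z_k ⋯ ∃ z_{k+m-1}, φ` with `φ` quantifier-free. -/
inductive Formula.IsExistential : {k : ℕ} → Formula k → Prop
  | of_isQF {k : ℕ} {φ : Formula k} : φ.IsQF → IsExistential φ
  | ex {k : ℕ} {φ : Formula (k + 1)} : IsExistential φ → IsExistential (Formula.ex φ)

/-- The formula `φ` with `k` free variables defines the set `A ⊆ ℕ^k`, regarded as a subset of
`ℤ^k`. -/
def Formula.Defines {k : ℕ} (φ : Formula k) (A : Set (Fin k → ℕ)) : Prop :=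
  ∀ x : Fin k → ℤ, φ.Holds x ↔ ∃ v ∈ A, ∀ i, x i = (v i : ℤ)

end PresburgerZ

/-! ### Monotonic counter machines -/

namespace MonotonicCM

/-- Guards over the counters `c_0, …, c_{n-1}`:
`φ ::= true | c < k | c = k | c > k | φ ∧ φ`, with `k ∈ ℤ`. -/
inductive Guard (n : ℕ) : Type
  | tt : Guard n
  | lt (c : Fin n) (k : ℤ) : Guard n
  | eq (c : Fin n) (k : ℤ) : Guard n
  | gt (c : Fin n) (k : ℤ) : Guard n
  | and (φ ψ : Guard n) : Guard n

/-- A counter valuation satisfies a guard. -/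
def Guard.Sat {n : ℕ} (v : Fin n → ℕ) : Guard n → Prop
  | .tt => True
  | .lt c k => (v c : ℤ) < k
  | .eq c k => (v c : ℤ) = k
  | .gt c k => (v c : ℤ) > k
  | .and φ ψ => φ.Sat v ∧ ψ.Sat v

/-- The length of a guard; constants are written in binary. -/
def Guard.size {n : ℕ} : Guard n → ℕ
  | .tt => 1
  | .lt _ k => 2 + PresburgerZ.intBits k
  | .eq _ k => 2 + PresburgerZ.intBits k
  | .gt _ k => 2 + PresburgerZ.intBits k
  | .and φ ψ => 1 + φ.size + ψ.size

/-- Counter operations. -/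
inductive Op (n : ℕ) : Type
  | reset (c : Fin n) : Op n
  | inc (c : Fin n) : Op n
  | nop : Op n

/-- The relation between the counter valuations before and after an operation. -/
def Op.Rel {n : ℕ} : Op n → (Fin n → ℕ) → (Fin n → ℕ) → Prop
  | .nop, v, v' => v = v'
  | .reset i, v, v' => v' i = 0 ∧ ∀ j, j ≠ i → v' j = v j
  | .inc i, v, v' => v' i = v i + 1 ∧ ∀ j, j ≠ i → v' j = v j

/-- An edge `⟨s, φ, op, s'⟩`. -/
structure Edge (n : ℕ) (S : Type*) where
  source : S
  guard : Guard n
  op : Op n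
  target : S

/-- A monotonic counter machine with counters `c_0, …, c_{n-1}` and set of states `S`
is given by its finite set of edges. -/
structure Machine (n : ℕ) (S : Type*) where
  edges : Finset (Edge n S)

variable {n : ℕ} {S : Type*}

/-- The transition relation on configurations. -/
def Machine.Step (M : Machine n S) (p q : S × (Fin n → ℕ)) : Prop :=
  ∃ e ∈ M.edges, e.source = p.1 ∧ e.target = q.1 ∧ e.guard.Sat p.2 ∧ e.op.Rel p.2 q.2

/-- The reachability relation: the reflexive transitive closure of the transition relation. -/
def Machine.Reach (M : Machine n S) : S × (Fin n → ℕ) → S × (Fin n → ℕ) → Prop :=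
  Relation.ReflTransGen M.Step

/-- The set of pairs `⟨v, v'⟩ ∈ ℕ^{2n}` such that `⟨s', v'⟩` is reachable from `⟨s, v⟩`. -/
def Machine.reachSet (M : Machine n S) (s s' : S) : Set (Fin (n + n) → ℕ) :=
  {w | ∃ v v' : Fin n → ℕ, w = Fin.append v v' ∧ M.Reach (s, v) (s', v')}

/-- The size of a machine: each counter and each state counts one, and each edge counts one for
each of its two states and for its operation, in addition to the length of its guard (with
constants in binary). -/
def Machine.size [Fintype S] (M : Machine n S) : ℕ :=
  n + Fintype.card S + ∑ e ∈ M.edges, (3 + e.guard.size)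

end MonotonicCM

/-! Counters only grow between resets. Truncating values at `B = 2 ^ M.size`, above every constant
of a guard, therefore loses nothing that guards can test, and the truncated values evolve on their
own (`Guard.sat_iff_of_truncate_eq`, `Op.Rel.truncate_eq`). The exact final value of a counter is
the number of its increments after its last reset, plus its initial value if it is never reset. Once
the states also guess which counters are past their last reset, final values become edge counts of
walks in a finite graph (`Machine.Reach.exists_walk`, `reach_of_walk`).

By Euler's theorem, edge multiplicities come from a walk exactly when they form a flow whose support
is reachable from the start; numerical ranks witness this reachability (`exists_walk_iff`). With
multiplicities and ranks as unknowns, every condition is a Boolean combination of linear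
constraints, which gives an existential formula. Its length is polynomial in the size of the graph
(`qfDef_reachPred`), and the graph has size `2 ^ poly(M.size)` (`card_absState_le`,
`card_absEdge_le_pow`). -/

/-! ### Directed multigraphs: walks, flows and Euler walks -/

namespace DirectedMultigraph

variable {E Q : Type*}

/-- A list of edges is a walk from `a` to `b`. -/
def IsWalk (src tgt : E → Q) : Q → List E → Q → Prop
  | a, [], b => a = b
  | a, e :: l, b => src e = a ∧ IsWalk src tgt (tgt e) l b

theorem isWalk_append {src tgt : E → Q} {a b : Q} {l₁ l₂ : List E} :
    IsWalk src tgt a (l₁ ++ l₂) b ↔ ∃ c, IsWalk src tgt a l₁ c ∧ IsWalk src tgt c l₂ b := by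
  induction l₁ generalizing a with
  | nil => simp [IsWalk]
  | cons e l ih => simp [IsWalk, ih, and_assoc]

/-- Adjacency through an edge of positive multiplicity. -/
def Adj (src tgt : E → Q) (f : E → ℕ) (q r : Q) : Prop :=
  ∃ e, 0 < f e ∧ src e = q ∧ tgt e = r

theorem IsWalk.reflTransGen_adj {src tgt : E → Q} {f : E → ℕ} {a b : Q} {l : List E}
    (h : IsWalk src tgt a l b) (hf : ∀ e ∈ l, 0 < f e) :
    ∀ e ∈ l, Relation.ReflTransGen (Adj src tgt f) a (src e) := by
  induction l generalizing a with
  | nil => simp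
  | cons d l ih =>
    obtain ⟨rfl, h⟩ := h
    intro e he
    rcases List.mem_cons.1 he with rfl | he
    · exact .refl
    · exact .head ⟨d, hf d (by simp), rfl, rfl⟩ (ih h (fun e he => hf e (by simp [he])) e he)

/-- Vertices reachable from `a` can be ranked so that each of them other than `a` has a
predecessor of smaller rank. -/
theorem exists_rank (G : Q → Q → Prop) (a : Q) :
    ∃ z : Q → ℕ, ∀ q, Relation.ReflTransGen G a q →
      q = a ∨ ∃ r, G r q ∧ z r < z q := by
  let R : ℕ → Q → Prop := fun k => Nat.rec (· = a) (fun _ P q => ∃ r, G r q ∧ P r) k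
  have hR : ∀ q, Relation.ReflTransGen G a q → ∃ k, R k q := by
    intro q hq
    induction hq with
    | refl => exact ⟨0, rfl⟩
    | tail _ h ih =>
      obtain ⟨k, hk⟩ := ih
      exact ⟨k + 1, _, h, hk⟩
  -- The rank is the distance from `a`: `R k q` says that some path of length `k` leads to `q`.
  refine ⟨fun q => sInf {k | R k q}, fun q hq => ?_⟩
  have hmem : R (sInf {k | R k q}) q := Nat.sInf_mem (s := {k | R k q}) (hR q hq)
  rcases hk : sInf {k | R k q} with _ | k
  · rw [hk] at hmem
    exact Or.inl hmem
  · rw [hk] at hmem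
    obtain ⟨r, hr, hkr⟩ := hmem
    have : sInf {k | R k r} ≤ k := Nat.sInf_le hkr
    exact Or.inr ⟨r, hr, by change sInf _ < sInf _; omega⟩

theorem eq_single_add [DecidableEq E] {f : E → ℕ} {e : E} (he : 0 < f e) : f = Pi.single e 1 + (f - Pi.single e 1) := by
  funext x
  rcases eq_or_ne x e with rfl | hx
  · simp only [Pi.add_apply, Pi.sub_apply, Pi.single_eq_same]
    omega
  · simp [hx]

theorem count_cons_eq [DecidableEq E] (e : E) (l : List E) :
    (fun x => (e :: l).count x) = Pi.single e 1 + fun x => l.count x := by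
  funext x
  rcases eq_or_ne x e with rfl | h
  · simp [add_comm]
  · simp [h, h.symm]

/-! ### Unit flows and Euler's theorem -/

variable [Fintype E] [DecidableEq Q]

/-- The total multiplicity of the edges `e` with `h e = q`. -/
def flowAt (h : E → Q) (f : E → ℕ) (q : Q) : ℕ := ∑ e, if h e = q then f e else 0

theorem flowAt_add (h : E → Q) (f g : E → ℕ) (q : Q) :
    flowAt h (f + g) q = flowAt h f q + flowAt h g q := by
  simp only [flowAt, ← Finset.sum_add_distrib]
  refine Finset.sum_congr rfl fun e _ => ?_
  split_ifs <;> simp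

theorem flowAt_single [DecidableEq E] (h : E → Q) (e : E) (q : Q) :
    flowAt h (Pi.single e 1) q = if q = h e then 1 else 0 := by
  rw [flowAt, Finset.sum_eq_single e]
  · simp [eq_comm]
  · intro d _ hd
    simp [hd]
  · simp

theorem flowAt_pos {h : E → Q} {f : E → ℕ} {q : Q} :
    0 < flowAt h f q ↔ ∃ e, h e = q ∧ 0 < f e := by
  rw [flowAt, Finset.sum_pos_iff]
  refine exists_congr fun e => ?_
  split_ifs with he <;> simp [he]

/-- `f` is a unit flow from `a` to `b`. -/
def IsFlow (src tgt : E → Q) (f : E → ℕ) (a b : Q) : Prop :=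
  ∀ q, flowAt src f q + (if q = b then 1 else 0) = flowAt tgt f q + (if q = a then 1 else 0)

variable {src tgt : E → Q} {f g : E → ℕ} {a b c : Q}

theorem IsFlow.add (hf : IsFlow src tgt f a b) (hg : IsFlow src tgt g b c) :
    IsFlow src tgt (f + g) a c := by
  intro q
  have h₁ := hf q
  have h₂ := hg q
  rw [flowAt_add, flowAt_add]
  omega

theorem IsFlow.of_add_left (hfg : IsFlow src tgt (f + g) a c) (hf : IsFlow src tgt f a b) :
    IsFlow src tgt g b c := by
  intro q
  have h₁ := hf q
  have h₂ := hfg q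
  rw [flowAt_add, flowAt_add] at h₂
  omega

variable [DecidableEq E]

theorem isFlow_single (e : E) : IsFlow src tgt (Pi.single e 1) (src e) (tgt e) := by
  intro q
  rw [flowAt_single, flowAt_single]
  omega

theorem IsWalk.isFlow {l : List E} (h : IsWalk src tgt a l b) :
    IsFlow src tgt (fun e => l.count e) a b := by
  induction l generalizing a with
  | nil =>
    obtain rfl : a = b := h
    simp [IsFlow, flowAt]
  | cons e l ih =>
    obtain ⟨rfl, h⟩ := h
    rw [count_cons_eq]
    exact (isFlow_single e).add (ih h)

/-- If `a ≠ b`, the balance at `a` forces an outgoing edge; deleting it leaves a unit flow from its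
target, with smaller total. No connectedness is needed because the walk may leave edges unused. -/
theorem IsFlow.exists_walk_of_sum (N : ℕ) :
    ∀ {f : E → ℕ} {a : Q}, ∑ e, f e = N → IsFlow src tgt f a b →
      ∃ l, IsWalk src tgt a l b ∧ ∀ e, l.count e ≤ f e := by
  induction N using Nat.strong_induction_on with
  | _ N ih =>
    intro f a hN hf
    by_cases hab : a = b
    · exact ⟨[], hab, by simp⟩
    have hpos : 0 < flowAt src f a := by
      have := hf a
      simp only [hab, if_true, if_false] at this
      omega
    obtain ⟨e, rfl, he⟩ := flowAt_pos.1 hpos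
    have hdec := eq_single_add he
    set g := f - Pi.single e 1
    have hsum : ∑ x, f x = 1 + ∑ x, g x := by
      rw [hdec]
      simp [Finset.sum_add_distrib]
    have hg : IsFlow src tgt g (tgt e) b := (hdec ▸ hf).of_add_left (isFlow_single e)
    obtain ⟨l, hl, hlg⟩ := ih _ (by omega) rfl hg
    refine ⟨e :: l, ⟨rfl, hl⟩, fun x => ?_⟩
    have h₁ := congrFun (count_cons_eq e l) x
    have h₂ := congrFun hdec x
    have := hlg x
    simp only [Pi.add_apply] at h₁ h₂
    omega

/-- A flow from `a` to `b` that leaves `a` by the edge `e` contains a walk starting with `e`. -/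
theorem IsFlow.exists_walk_cons (hf : IsFlow src tgt f a b) {e : E} (hea : src e = a)
    (he : 0 < f e) : ∃ l, IsWalk src tgt a (e :: l) b ∧ ∀ x, (e :: l).count x ≤ f x := by
  subst hea
  have hdec := eq_single_add he
  set g := f - Pi.single e 1
  have hg : IsFlow src tgt g (tgt e) b := (hdec ▸ hf).of_add_left (isFlow_single e)
  obtain ⟨l, hl, hlg⟩ := IsFlow.exists_walk_of_sum _ rfl hg
  refine ⟨l, ⟨rfl, hl⟩, fun x => ?_⟩
  have h₁ := congrFun (count_cons_eq e l) x
  have h₂ := congrFun hdec x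
  have := hlg x
  simp only [Pi.add_apply] at h₁ h₂
  omega

theorem length_le_sum {l : List E} (h : ∀ e, l.count e ≤ f e) : l.length ≤ ∑ e, f e := by
  have : l.length = ∑ e, l.count e := by
    have := Multiset.sum_count_eq_card (s := Finset.univ) (m := (l : Multiset E)) (by simp)
    simpa using this.symm
  rw [this]
  exact Finset.sum_le_sum fun e _ => h e

/-- **Euler's theorem** for walks in directed multigraphs: a connected flow from `a` to `b` is the
family of multiplicities of a walk from `a` to `b`. -/
theorem IsFlow.exists_euler_walk (hf : IsFlow src tgt f a b)
    (hconn : ∀ e, 0 < f e → Relation.ReflTransGen (Adj src tgt f) a (src e)) :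
    ∃ l, IsWalk src tgt a l b ∧ ∀ e, l.count e = f e := by
  let P : ℕ → Prop := fun k => ∃ l, IsWalk src tgt a l b ∧ (∀ e, l.count e ≤ f e) ∧ l.length = k
  obtain ⟨l₀, hl₀, hc₀⟩ := IsFlow.exists_walk_of_sum _ rfl hf
  have hP₀ : P l₀.length := ⟨l₀, hl₀, hc₀, rfl⟩
  classical
  -- Take a longest walk within the multiplicities `f`; it will turn out to exhaust them.
  obtain ⟨l, hl, hc, hlen⟩ : P (Nat.findGreatest P (∑ e, f e)) :=
    Nat.findGreatest_spec (length_le_sum hc₀) hP₀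
  have hmax : ∀ l', IsWalk src tgt a l' b → (∀ e, l'.count e ≤ f e) → l'.length ≤ l.length :=
    fun l' h₁ h₂ => hlen ▸ Nat.le_findGreatest (length_le_sum h₂) ⟨l', h₁, h₂, rfl⟩
  let g : E → ℕ := fun e => f e - l.count e
  have hdec : f = (fun e => l.count e) + g := by
    funext e
    have := hc e
    simp only [Pi.add_apply, g]
    omega
  have hg : IsFlow src tgt g b b := (hdec ▸ hf).of_add_left hl.isFlow
  -- The two end terms cancel, so the remainder is a circulation, which can be based at any vertex.
  have hcirc : ∀ q, IsFlow src tgt g q q := by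
    intro q r
    have := hg r
    omega
  -- A leftover edge out of a vertex of the walk starts a closed walk in the remainder; splicing it
  -- in would contradict maximality.
  have hsat : ∀ l₁ l₂ q, l = l₁ ++ l₂ → IsWalk src tgt a l₁ q → IsWalk src tgt q l₂ b →
      ∀ e, src e = q → g e = 0 := by
    intro l₁ l₂ q hl₁₂ h₁ h₂ e heq
    by_contra hge
    obtain ⟨m, hm, hmg⟩ := (hcirc q).exists_walk_cons heq (Nat.pos_of_ne_zero hge)
    have := hmax (l₁ ++ ((e :: m) ++ l₂))
      (isWalk_append.2 ⟨q, h₁, isWalk_append.2 ⟨q, hm, h₂⟩⟩) (fun x => by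
        have h₃ := hmg x
        have h₄ := congrFun hdec x
        simp only [Pi.add_apply, hl₁₂, List.count_append] at h₄ ⊢
        omega)
    simp only [hl₁₂, List.length_append, List.length_cons] at this
    omega
  -- The walk visits every vertex reachable in the support: edges leaving a visited vertex have no
  -- leftover, so those with positive multiplicity occur in `l`.
  have hreach : ∀ q, Relation.ReflTransGen (Adj src tgt f) a q →
      ∃ l₁ l₂, l = l₁ ++ l₂ ∧ IsWalk src tgt a l₁ q ∧ IsWalk src tgt q l₂ b := by
    intro q hq
    induction hq with
    | refl => exact ⟨[], l, rfl, rfl, hl⟩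
    | tail _ h ih =>
      obtain ⟨e, he, rfl, rfl⟩ := h
      obtain ⟨l₁, l₂, h₀, h₁, h₂⟩ := ih
      have hge : g e = 0 := hsat l₁ l₂ _ h₀ h₁ h₂ e rfl
      have hel : e ∈ l := List.count_pos_iff.1 (by
        have := hc e
        simp only [g] at hge
        omega)
      obtain ⟨m₁, m₂, hm⟩ := List.append_of_mem hel
      rw [hm] at hl
      obtain ⟨r, hr₁, hr₂⟩ := isWalk_append.1 hl
      obtain ⟨rfl, hr₂⟩ := hr₂
      exact ⟨m₁ ++ [e], m₂, by simp [hm], isWalk_append.2 ⟨_, hr₁, rfl, rfl⟩, hr₂⟩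
  refine ⟨l, hl, fun e => ?_⟩
  by_contra hne
  have hlt : l.count e < f e := lt_of_le_of_ne (hc e) hne
  obtain ⟨l₁, l₂, h₀, h₁, h₂⟩ := hreach _ (hconn e (by omega))
  have := hsat l₁ l₂ _ h₀ h₁ h₂ e rfl
  simp only [g] at this
  omega

/-- A family of multiplicities is that of a walk from `a` to `b` if and only if it is a flow whose
support is connected, as witnessed by a rank function. -/
theorem exists_walk_iff :
    (∃ l, IsWalk src tgt a l b ∧ ∀ e, l.count e = f e) ↔
      IsFlow src tgt f a b ∧ ∃ z : Q → ℕ, ∀ q, q = a ∨ (∀ e, src e = q → f e = 0) ∨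
        ∃ e, tgt e = q ∧ 0 < f e ∧ z (src e) < z q := by
  constructor
  · rintro ⟨l, hl, hc⟩
    obtain rfl : (fun e => l.count e) = f := funext hc
    refine ⟨hl.isFlow, ?_⟩
    obtain ⟨z, hz⟩ := exists_rank (Adj src tgt fun e => l.count e) a
    refine ⟨z, fun q => ?_⟩
    by_cases hq : ∀ e, src e = q → l.count e = 0
    · exact Or.inr (Or.inl hq)
    · push Not at hq
      obtain ⟨e, rfl, he⟩ := hq
      rcases hz _ (hl.reflTransGen_adj (fun e he => List.count_pos_iff.2 he) e
        (List.count_pos_iff.1 (Nat.pos_of_ne_zero he))) with h | ⟨_, ⟨d, hd, rfl, h⟩, hlt⟩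
      · exact Or.inl h
      · exact Or.inr (Or.inr ⟨d, h, hd, hlt⟩)
  · rintro ⟨hf, z, hz⟩
    refine hf.exists_euler_walk fun e he => ?_
    -- Following predecessors lowers the rank, so the descent can only stop at `a`.
    induction hk : z (src e) using Nat.strong_induction_on generalizing e with
    | _ k ih =>
      rcases hz (src e) with h | h | ⟨d, hd, hd₀, hlt⟩
      · rw [h]
      · exact absurd (h e rfl) he.ne'
      · exact .tail (ih _ (hk ▸ hlt) d hd₀ rfl) ⟨d, hd₀, rfl, hd⟩

end DirectedMultigraph

/-! ### Definability by quantifier-free formulas of bounded size -/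

namespace PresburgerZ

/-- The function `g` is given by a term of length at most `(T + 8) ^ j`. -/
def TermDef (T : ℕ) {k : ℕ} (j : ℕ) (g : (Fin k → ℤ) → ℤ) : Prop :=
  ∃ t : Term k, t.size ≤ (T + 8) ^ j ∧ ∀ x, t.eval x = g x

/-- The predicate `P` is given by a quantifier-free formula of length at most `(T + 8) ^ j`. -/
def QFDef (T : ℕ) {k : ℕ} (j : ℕ) (P : (Fin k → ℤ) → Prop) : Prop :=
  ∃ φ : Formula k, φ.IsQF ∧ φ.size ≤ (T + 8) ^ j ∧ ∀ x, φ.Holds x ↔ P x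

theorem size_le_self (m : ℕ) : Nat.size m ≤ m := Nat.size_le.2 Nat.lt_two_pow_self

theorem pow_le_max_left (T i j : ℕ) : (T + 8) ^ i ≤ (T + 8) ^ max i j :=
  Nat.pow_le_pow_right (by omega) (le_max_left i j)

theorem pow_le_max_right (T i j : ℕ) : (T + 8) ^ j ≤ (T + 8) ^ max i j :=
  Nat.pow_le_pow_right (by omega) (le_max_right i j)

/-- Absorbs the length of one binary connective into one more factor `T + 8`, so that exponents
record only nesting depth. -/
theorem add_mul_pow_le (T j : ℕ) : 8 * (T + 8) ^ j ≤ (T + 8) ^ (j + 1) := by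
  rw [pow_succ, mul_comm]
  exact Nat.mul_le_mul_left _ (by omega)

/-- Absorbs a sum or disjunction over at most `T` indices: each costs its own length plus one
connective, and 5 covers the empty case. -/
theorem mul_add_pow_le {N T : ℕ} (h : N ≤ T) (j : ℕ) :
    N * (1 + (T + 8) ^ j) + 5 ≤ (T + 8) ^ (j + 2) := by
  have h₁ : 0 < (T + 8) ^ j := Nat.pow_pos (by omega)
  rw [pow_add]
  generalize (T + 8) ^ j = X at *
  nlinarith [Nat.mul_le_mul_right (1 + X) h, Nat.mul_le_mul_left T h₁,
    Nat.mul_le_mul_left (T * T) h₁]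

section

variable {T k i j : ℕ} {f g : (Fin k → ℤ) → ℤ} {P R : (Fin k → ℤ) → Prop}

theorem TermDef.const {c : ℤ} (hc : c.natAbs ≤ T + 6) : TermDef T 1 fun _ : Fin k → ℤ => c := by
  refine ⟨.const c, ?_, fun _ => rfl⟩
  have := size_le_self c.natAbs
  rw [Term.size, intBits, pow_one]
  omega

theorem TermDef.var (hk : k ≤ T) (i : Fin k) : TermDef T 1 fun x : Fin k → ℤ => x i := by
  refine ⟨.var i, ?_, fun _ => rfl⟩
  have := size_le_self i
  rw [Term.size, pow_one]
  omega

theorem TermDef.ite (p : Prop) [Decidable p] (hf : TermDef T 1 f) :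
    TermDef T 1 fun x => if p then f x else 0 := by
  split_ifs
  · exact hf
  · exact .const (by simp)

theorem TermDef.add (hf : TermDef T i f) (hg : TermDef T j g) :
    TermDef T (max i j + 1) fun x => f x + g x := by
  obtain ⟨t, ht, ht'⟩ := hf
  obtain ⟨u, hu, hu'⟩ := hg
  refine ⟨.add t u, ?_, fun x => by rw [Term.eval, ht', hu']⟩
  have := add_mul_pow_le T (max i j)
  have := pow_le_max_left T i j
  have := pow_le_max_right T i j
  have : 0 < (T + 8) ^ max i j := Nat.pow_pos (by omega)
  rw [Term.size]
  omega

theorem TermDef.sum {ι : Type*} [Fintype ι] (hι : Fintype.card ι ≤ T)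
    {f : ι → (Fin k → ℤ) → ℤ} (hf : ∀ a, TermDef T j (f a)) :
    TermDef T (j + 2) fun x => ∑ a, f a x := by
  have key : ∀ l : List ι, ∃ t : Term k, t.size ≤ l.length * (1 + (T + 8) ^ j) + 5 ∧
      ∀ x, t.eval x = (l.map fun a => f a x).sum := by
    intro l
    induction l with
    | nil => exact ⟨.const 0, by simp [Term.size, intBits], fun _ => rfl⟩
    | cons a l ih =>
      obtain ⟨t, ht, ht'⟩ := hf a
      obtain ⟨u, hu, hu'⟩ := ih
      refine ⟨.add t u, ?_, fun x => by rw [Term.eval, ht', hu', List.map_cons, List.sum_cons]⟩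
      rw [Term.size, List.length_cons, Nat.succ_mul]
      omega
  obtain ⟨t, ht, ht'⟩ := key Finset.univ.toList
  refine ⟨t, ht.trans ?_, fun x => by rw [ht', Finset.sum_map_toList]⟩
  rw [Finset.length_toList]
  exact mul_add_pow_le hι j

theorem QFDef.mono (hP : QFDef T i P) (h : i ≤ j) : QFDef T j P := by
  obtain ⟨φ, h₁, h₂, h₃⟩ := hP
  exact ⟨φ, h₁, h₂.trans (Nat.pow_le_pow_right (by omega) h), h₃⟩

theorem QFDef.congr (hP : QFDef T j P) (h : ∀ x, P x ↔ R x) : QFDef T j R := by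
  obtain ⟨φ, h₁, h₂, h₃⟩ := hP
  exact ⟨φ, h₁, h₂, fun x => (h₃ x).trans (h x)⟩

theorem QFDef.le (hf : TermDef T i f) (hg : TermDef T j g) :
    QFDef T (max i j + 1) fun x => f x ≤ g x := by
  obtain ⟨t, ht, ht'⟩ := hf
  obtain ⟨u, hu, hu'⟩ := hg
  refine ⟨.le t u, .le t u, ?_, fun x => by rw [Formula.Holds, ht', hu']⟩
  have := add_mul_pow_le T (max i j)
  have := pow_le_max_left T i j
  have := pow_le_max_right T i j
  have : 0 < (T + 8) ^ max i j := Nat.pow_pos (by omega)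
  rw [Formula.size]
  omega

theorem QFDef.not (hP : QFDef T j P) : QFDef T (j + 1) fun x => ¬ P x := by
  obtain ⟨φ, h₁, h₂, h₃⟩ := hP
  refine ⟨.not φ, .not h₁, ?_, fun x => by rw [Formula.Holds, h₃]⟩
  have := add_mul_pow_le T j
  have : 0 < (T + 8) ^ j := Nat.pow_pos (by omega)
  rw [Formula.size]
  omega

theorem QFDef.and (hP : QFDef T i P) (hR : QFDef T j R) :
    QFDef T (max i j + 1) fun x => P x ∧ R x := by
  obtain ⟨φ, h₁, h₂, h₃⟩ := hP
  obtain ⟨ψ, h₄, h₅, h₆⟩ := hR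
  refine ⟨.and φ ψ, .and h₁ h₄, ?_, fun x => by rw [Formula.Holds, h₃, h₆]⟩
  have := add_mul_pow_le T (max i j)
  have := pow_le_max_left T i j
  have := pow_le_max_right T i j
  have : 0 < (T + 8) ^ max i j := Nat.pow_pos (by omega)
  rw [Formula.size]
  omega

theorem QFDef.or (hP : QFDef T i P) (hR : QFDef T j R) :
    QFDef T (max i j + 1) fun x => P x ∨ R x := by
  obtain ⟨φ, h₁, h₂, h₃⟩ := hP
  obtain ⟨ψ, h₄, h₅, h₆⟩ := hR
  refine ⟨.or φ ψ, .or h₁ h₄, ?_, fun x => by rw [Formula.Holds, h₃, h₆]⟩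
  have := add_mul_pow_le T (max i j)
  have := pow_le_max_left T i j
  have := pow_le_max_right T i j
  have : 0 < (T + 8) ^ max i j := Nat.pow_pos (by omega)
  rw [Formula.size]
  omega

theorem QFDef.lt (hf : TermDef T i f) (hg : TermDef T j g) :
    QFDef T (max j i + 2) fun x => f x < g x :=
  (QFDef.le hg hf).not.congr fun _ => not_le

theorem QFDef.eq (hf : TermDef T i f) (hg : TermDef T j g) :
    QFDef T (max (max i j + 1) (max j i + 1) + 1) fun x => f x = g x :=
  ((QFDef.le hf hg).and (QFDef.le hg hf)).congr fun _ => le_antisymm_iff.symm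

/-- Facts about the abstraction do not involve the variables, so they are decided when the formula
is written. -/
theorem QFDef.prop (p : Prop) : QFDef T 1 fun _ : Fin k → ℤ => p := by
  by_cases hp : p
  · exact ⟨.le (.const 0) (.const 0), .le _ _, by simp [Formula.size, Term.size, intBits],
      fun x => by simp [Formula.Holds, hp]⟩
  · exact ⟨.le (.const 1) (.const 0), .le _ _, by simp [Formula.size, Term.size, intBits],
      fun x => by simp [Formula.Holds, Term.eval, hp]⟩

theorem QFDef.exists {ι : Type*} [Fintype ι] (hι : Fintype.card ι ≤ T)
    {P : ι → (Fin k → ℤ) → Prop} (hP : ∀ a, QFDef T j (P a)) :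
    QFDef T (j + 2) fun x => ∃ a, P a x := by
  have key : ∀ l : List ι, ∃ φ : Formula k, φ.IsQF ∧
      φ.size ≤ l.length * (1 + (T + 8) ^ j) + 5 ∧ ∀ x, φ.Holds x ↔ ∃ a ∈ l, P a x := by
    intro l
    induction l with
    | nil =>
      exact ⟨.le (.const 1) (.const 0), .le _ _, by simp [Formula.size, Term.size, intBits],
        fun x => by simp [Formula.Holds, Term.eval]⟩
    | cons a l ih =>
      obtain ⟨φ, h₁, h₂, h₃⟩ := hP a
      obtain ⟨ψ, h₄, h₅, h₆⟩ := ih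
      refine ⟨.or φ ψ, .or h₁ h₄, ?_, fun x => by rw [Formula.Holds, h₃, h₆]; simp⟩
      rw [Formula.size, List.length_cons, Nat.succ_mul]
      omega
  obtain ⟨φ, h₁, h₂, h₃⟩ := key Finset.univ.toList
  refine ⟨φ, h₁, h₂.trans ?_, fun x => by simp [h₃]⟩
  rw [Finset.length_toList]
  exact mul_add_pow_le hι j

theorem QFDef.forall {ι : Type*} [Fintype ι] (hι : Fintype.card ι ≤ T)
    {P : ι → (Fin k → ℤ) → Prop} (hP : ∀ a, QFDef T j (P a)) :
    QFDef T (j + 4) fun x => ∀ a, P a x :=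
  (QFDef.exists hι fun a => (hP a).not).not.congr fun x => by simp

end

/-- Blocks of existential quantifiers in front of an existential formula. -/
theorem Formula.IsExistential.exists_block {k : ℕ} (m : ℕ) (φ : Formula (k + m))
    (hφ : φ.IsExistential) :
    ∃ ψ : Formula k, ψ.IsExistential ∧ ψ.size ≤ m * (2 + (k + m)) + φ.size ∧
      ∀ x, ψ.Holds x ↔ ∃ y : Fin m → ℤ, φ.Holds (Fin.append x y) := by
  induction m with
  | zero =>
    refine ⟨φ, hφ, by omega, fun x => ?_⟩
    have : ∀ y : Fin 0 → ℤ, Fin.append x y = x := fun y => by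
      rw [Subsingleton.elim y Fin.elim0, Fin.append_elim0]
      rfl
    simp [this]
  | succ m ih =>
    obtain ⟨ψ, h₁, h₂, h₃⟩ := ih (.ex φ) (.ex hφ)
    refine ⟨ψ, h₁, ?_, fun x => ?_⟩
    · have := size_le_self (k + m)
      rw [Formula.size] at h₂
      nlinarith
    · rw [h₃]
      constructor
      · rintro ⟨y, a, h⟩
        exact ⟨Fin.snoc y a, by rwa [Fin.append_snoc]⟩
      · rintro ⟨y, h⟩
        refine ⟨Fin.init y, y (Fin.last m), ?_⟩
        rw [← Fin.append_snoc, Fin.snoc_init_self]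
        exact h

/-- Existential quantification over integers indexed by a finite type. -/
theorem QFDef.exists_formula {T k j : ℕ} {W : Type*} [Fintype W]
    (hT : k + Fintype.card W ≤ T) {P : (Fin k → ℤ) → (W → ℤ) → Prop}
    (hP : QFDef T j fun x : Fin (k + Fintype.card W) → ℤ =>
      P (fun i => x (Fin.castAdd _ i)) (fun w => x (Fin.natAdd k (Fintype.equivFin W w)))) :
    ∃ ψ : Formula k, ψ.IsExistential ∧ ψ.size ≤ (T + 8) ^ (j + 2) ∧
      ∀ x, ψ.Holds x ↔ ∃ y : W → ℤ, P x y := by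
  obtain ⟨φ, h₁, h₂, h₃⟩ := hP
  obtain ⟨ψ, h₄, h₅, h₆⟩ := Formula.IsExistential.exists_block _ φ (.of_isQF h₁)
  refine ⟨ψ, h₄, ?_, fun x => ?_⟩
  · have h₇ : 0 < (T + 8) ^ j := Nat.pow_pos (by omega)
    have h₈ : Fintype.card W * (2 + (k + Fintype.card W)) ≤ T * (2 + T) :=
      Nat.mul_le_mul (by omega) (by omega)
    rw [pow_add]
    generalize (T + 8) ^ j = X at *
    nlinarith [Nat.mul_le_mul_left T h₇, Nat.mul_le_mul_left (T * T) h₇]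
  · simp only [h₆, h₃, Fin.append_left, Fin.append_right]
    constructor
    · rintro ⟨y, h⟩
      exact ⟨_, h⟩
    · rintro ⟨y, h⟩
      exact ⟨fun i => y ((Fintype.equivFin W).symm i), by simpa using h⟩

end PresburgerZ

/-! ### The finite abstraction of a monotonic counter machine -/

namespace MonotonicCM

open DirectedMultigraph PresburgerZ

variable {n : ℕ} {S : Type*}

/-- Counter values truncated at `B`. -/
def truncate (B : ℕ) (v : Fin n → ℕ) : Fin n → Fin (B + 1) :=
  fun c => ⟨min (v c) B, by omega⟩

theorem truncate_eq_iff {B : ℕ} {v : Fin n → ℕ} {r : Fin n → Fin (B + 1)} :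
    truncate B v = r ↔ ∀ c, min (v c) B = r c := by
  simp [funext_iff, truncate, Fin.ext_iff]

theorem truncate_eq_truncate_iff {B : ℕ} {v u : Fin n → ℕ} :
    truncate B v = truncate B u ↔ ∀ c, min (v c) B = min (u c) B :=
  truncate_eq_iff

/-- Every constant of `φ` has absolute value below `2 ^ φ.size`, so no comparison separates two
values that are at least `B`. -/
theorem Guard.sat_iff_of_truncate_eq {B : ℕ} {v u : Fin n → ℕ}
    (h : truncate B v = truncate B u) (φ : Guard n) (hφ : 2 ^ φ.size ≤ B) :
    φ.Sat v ↔ φ.Sat u := by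
  rw [truncate_eq_truncate_iff] at h
  have hk : ∀ k : ℤ, 2 ^ (2 + intBits k) ≤ B → k.natAbs < B := fun k hB =>
    (Nat.size_le.1 (by rw [intBits]; omega)).trans_le hB
  induction φ with
  | tt => rfl
  | lt c k | eq c k | gt c k =>
    have := hk k hφ
    have := h c
    simp only [Guard.Sat]
    omega
  | and φ ψ ih₁ ih₂ =>
    rw [Guard.size] at hφ
    exact and_congr (ih₁ ((Nat.pow_le_pow_right (by omega) (by omega)).trans hφ))
      (ih₂ ((Nat.pow_le_pow_right (by omega) (by omega)).trans hφ))

theorem Op.exists_rel (op : Op n) (v : Fin n → ℕ) : ∃ v', op.Rel v v' := by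
  cases op with
  | reset c => exact ⟨Function.update v c 0, by simp, fun j hj => by simp [hj]⟩
  | inc c => exact ⟨Function.update v c (v c + 1), by simp, fun j hj => by simp [hj]⟩
  | nop => exact ⟨v, rfl⟩

/-- Resets and increments act on truncated values: `min (m + 1) B` depends only on `min m B`. A
decrement would break this. -/
theorem Op.Rel.truncate_eq {B : ℕ} {op : Op n} {v v' u u' : Fin n → ℕ} (hv : op.Rel v v')
    (hu : op.Rel u u') (h : truncate B v = truncate B u) : truncate B v' = truncate B u' := by
  rw [truncate_eq_truncate_iff] at h ⊢
  intro c
  have hc := h c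
  cases op with
  | reset i | inc i =>
    rcases eq_or_ne c i with rfl | hne
    · have := hv.1
      have := hu.1
      omega
    · rw [hv.2 c hne, hu.2 c hne, hc]
  | nop =>
    obtain rfl : v = v' := hv
    obtain rfl : u = u' := hu
    exact hc

/-- The set of counters that are not reset any more, before an operation, given this set after the
operation. -/
def Op.before : Op n → Finset (Fin n) → Finset (Fin n)
  | .reset c, D => D.erase c
  | .inc _, D => D
  | .nop, D => D

/-- The operation increments a counter `c` that is not reset any more. -/
def Op.counts : Op n → Finset (Fin n) → Fin n → Bool
  | .inc i, D, c => decide (c = i ∧ c ∈ D)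
  | .reset _, _, _ => false
  | .nop, _, _ => false

/-- One step of the bookkeeping that telescopes along a run. A counter contributes only after its
last reset; at that reset its value is 0 and it enters the set. -/
theorem Op.Rel.value {op : Op n} {v v' : Fin n → ℕ} (h : op.Rel v v') (D : Finset (Fin n))
    (c : Fin n) : (if c ∈ D then v' c else 0) =
      (if c ∈ op.before D then v c else 0) + if op.counts D c = true then 1 else 0 := by
  cases op with
  | reset i =>
    rcases eq_or_ne c i with rfl | hne
    · simp [Op.before, Op.counts, h.1]
    · simp [Op.before, Op.counts, h.2 c hne, hne]
  | inc i =>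
    rcases eq_or_ne c i with rfl | hne
    · by_cases hD : c ∈ D <;> simp [Op.before, Op.counts, h.1, hD]
    · by_cases hD : c ∈ D <;> simp [Op.before, Op.counts, h.2 c hne, hne, hD]
  | nop =>
    obtain rfl : v = v' := h
    by_cases hD : c ∈ D <;> simp [Op.before, Op.counts, hD]

/-- States of the abstraction: a state, truncated counter values, and the set of counters that are
not reset any more. -/
abbrev AbsState (n : ℕ) (S : Type*) (B : ℕ) : Type _ :=
  S × (Fin n → Fin (B + 1)) × Finset (Fin n)

/-- An edge of the machine induces an edge of its abstraction. -/
def IsAbsEdge {B : ℕ} (q : AbsState n S B) (e : Edge n S) (r : AbsState n S B) : Prop :=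
  e.source = q.1 ∧ e.target = r.1 ∧ e.op.before r.2.2 = q.2.2 ∧
    ∃ v v', truncate B v = q.2.1 ∧ truncate B v' = r.2.1 ∧ e.guard.Sat v ∧ e.op.Rel v v'

/-- Edges of the abstraction. -/
def AbsEdge (M : Machine n S) (B : ℕ) : Type _ :=
  {t : AbsState n S B × {e // e ∈ M.edges} × AbsState n S B // IsAbsEdge t.1 t.2.1.1 t.2.2}

section

variable {M : Machine n S} {B : ℕ}

/-- The source of an edge of the abstraction. -/
def AbsEdge.src (e : AbsEdge M B) : AbsState n S B := e.1.1

/-- The target of an edge of the abstraction. -/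
def AbsEdge.tgt (e : AbsEdge M B) : AbsState n S B := e.1.2.2

/-- The edge of the machine that induces an edge of the abstraction. -/
def AbsEdge.edge (e : AbsEdge M B) : Edge n S := e.1.2.1.1

theorem AbsEdge.isAbsEdge (e : AbsEdge M B) : IsAbsEdge e.src e.edge e.tgt := e.2

theorem AbsEdge.edge_mem (e : AbsEdge M B) : e.edge ∈ M.edges := e.1.2.1.2

/-- The edge increments a counter `c` that is not reset any more. -/
def AbsEdge.counts (c : Fin n) (e : AbsEdge M B) : Bool :=
  e.edge.op.counts e.tgt.2.2 c

noncomputable instance : DecidableEq (AbsEdge M B) := Classical.decEq _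

noncomputable instance [Fintype S] : Fintype (AbsEdge M B) :=
  Fintype.ofInjective (fun e => e.1) Subtype.val_injective

theorem card_absEdge_le [Fintype S] :
    Fintype.card (AbsEdge M B) ≤
      Fintype.card (AbsState n S B) * (M.edges.card * Fintype.card (AbsState n S B)) := by
  have := Fintype.card_le_of_injective (fun e : AbsEdge M B => e.1) Subtype.val_injective
  simpa using this

variable [Fintype S]

theorem flowAt_count_cons {h : AbsEdge M B → Bool} (e : AbsEdge M B) (l : List (AbsEdge M B)) :
    flowAt h (fun x => (e :: l).count x) true =
      (if h e = true then 1 else 0) + flowAt h (fun x => l.count x) true := by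
  rw [count_cons_eq, flowAt_add, flowAt_single]
  simp only [eq_comm]

theorem Machine.Reach.exists_walk {s s' : S} {v v' : Fin n → ℕ} (h : M.Reach (s, v) (s', v')) :
    ∃ D l, IsWalk AbsEdge.src AbsEdge.tgt ((s, truncate B v, D) : AbsState n S B) l
        (s', truncate B v', Finset.univ) ∧
      ∀ c, v' c = (if c ∈ D then v c else 0) +
        flowAt (AbsEdge.counts (M := M) (B := B) c) (fun e => l.count e) true := by
  suffices ∀ p, M.Reach p (s', v') →
      ∃ D l, IsWalk AbsEdge.src AbsEdge.tgt ((p.1, truncate B p.2, D) : AbsState n S B) l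
        (s', truncate B v', Finset.univ) ∧
      ∀ c, v' c = (if c ∈ D then p.2 c else 0) +
        flowAt (AbsEdge.counts (M := M) (B := B) c) (fun e => l.count e) true from this _ h
  clear h
  intro p h
  -- Backwards, since `D` depends on the rest of the run; at its end no counter is reset any more.
  induction h using Relation.ReflTransGen.head_induction_on with
  | refl => exact ⟨Finset.univ, [], rfl, fun c => by simp [flowAt]⟩
  | @head p q hpq _ ih =>
    obtain ⟨D, l, hl, hc⟩ := ih
    obtain ⟨e, he, hs, ht, hg, hop⟩ := hpq
    let d : AbsEdge M B := ⟨((p.1, truncate B p.2, e.op.before D), ⟨e, he⟩,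
      (q.1, truncate B q.2, D)), hs, ht, rfl, _, _, rfl, rfl, hg, hop⟩
    refine ⟨e.op.before D, d :: l, ⟨rfl, hl⟩, fun c => ?_⟩
    rw [flowAt_count_cons, hc, hop.value D c, add_assoc]
    rfl

/-- An abstract edge is realized by some valuation `u`, but guards and truncated successors depend
only on truncations, so the actual `v` can take the same edge. -/
theorem reach_of_walk (hB : ∀ e ∈ M.edges, 2 ^ e.guard.size ≤ B) {s' : S}
    {r : Fin n → Fin (B + 1)} (l : List (AbsEdge M B)) (s : S) (v : Fin n → ℕ)
    (D : Finset (Fin n))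
    (h : IsWalk AbsEdge.src AbsEdge.tgt (s, truncate B v, D) l (s', r, Finset.univ)) :
    ∃ v', M.Reach (s, v) (s', v') ∧ ∀ c, v' c = (if c ∈ D then v c else 0) +
      flowAt (AbsEdge.counts (M := M) (B := B) c) (fun e => l.count e) true := by
  induction l generalizing s v D with
  | nil =>
    obtain ⟨rfl, -, rfl⟩ : s = s' ∧ truncate B v = r ∧ D = Finset.univ := by
      simpa [IsWalk] using h
    exact ⟨v, .refl, fun c => by simp [flowAt]⟩
  | cons d l ih =>
    obtain ⟨hd, hl⟩ := h
    obtain ⟨hs, ht, hD, u, u', hu, hu', hg, hop⟩ := d.isAbsEdge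
    obtain ⟨v₁, hv₁⟩ := d.edge.op.exists_rel v
    rw [hd] at hs hD hu
    have hr₁ : truncate B v₁ = d.tgt.2.1 := (hv₁.truncate_eq hop hu.symm).trans hu'
    obtain ⟨v', hr, hc⟩ := ih d.tgt.1 v₁ d.tgt.2.2 (by rwa [hr₁])
    refine ⟨v', .head ⟨d.edge, d.edge_mem, hs, ht, ?_, hv₁⟩ hr, fun c => ?_⟩
    · exact (Guard.sat_iff_of_truncate_eq hu d.edge.guard (hB _ d.edge_mem)).1 hg
    · rw [flowAt_count_cons, hc, hv₁.value d.tgt.2.2 c, add_assoc, hD]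
      rfl

/-- Reachability in terms of connected flows in the abstraction. -/
theorem reach_iff [DecidableEq S] (hB : ∀ e ∈ M.edges, 2 ^ e.guard.size ≤ B) {s s' : S}
    {v v' : Fin n → ℕ} :
    M.Reach (s, v) (s', v') ↔ ∃ (f : AbsEdge M B → ℕ) (z : AbsState n S B → ℕ)
      (a b : AbsState n S B), (a.1 = s ∧ b.1 = s' ∧ b.2.2 = Finset.univ) ∧
      (∀ c, min (v c) B = a.2.1 c) ∧
      (∀ q, flowAt AbsEdge.src f q + (if q = b then 1 else 0) =
        flowAt AbsEdge.tgt f q + (if q = a then 1 else 0)) ∧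
      (∀ q, q = a ∨ (∀ e : AbsEdge M B, e.src = q → f e = 0) ∨
        ∃ e : AbsEdge M B, e.tgt = q ∧ 0 < f e ∧ z e.src < z q) ∧
      ∀ c, v' c = (if c ∈ a.2.2 then v c else 0) + flowAt (AbsEdge.counts c) f true := by
  constructor
  · intro h
    obtain ⟨D, l, hl, hc⟩ := h.exists_walk (B := B)
    obtain ⟨hf, z, hz⟩ := exists_walk_iff.1 ⟨l, hl, fun _ => rfl⟩
    exact ⟨_, z, _, _, ⟨rfl, rfl, rfl⟩, fun _ => rfl, hf, hz, hc⟩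
  · rintro ⟨f, z, ⟨s, t, D⟩, ⟨s', r, D'⟩, ⟨rfl, rfl, rfl⟩, ht, hf, hz, hc⟩
    obtain ⟨l, hl, hlf⟩ := exists_walk_iff.2 ⟨hf, z, hz⟩
    obtain rfl := truncate_eq_iff.2 ht
    obtain ⟨u, hu, huc⟩ := reach_of_walk hB l s v D hl
    obtain rfl : (fun e => l.count e) = f := funext hlf
    -- The multiplicities determine the final valuation, so it does not matter which Euler walk was
    -- chosen.
    obtain rfl : u = v' := funext fun c => (huc c).trans (hc c).symm
    exact hu

end

end MonotonicCM

/-! ### The formula for reachability -/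

namespace MonotonicCM

open DirectedMultigraph PresburgerZ

variable {n : ℕ} {S : Type*} {M : Machine n S} {B : ℕ}

section

variable [Fintype S] [DecidableEq S]

/-- The predicate on integers `x` (the counter values before and after) and `y` (the multiplicities
of edges and the ranks of states of the abstraction) expressing that the multiplicities form a
connected flow that leads from the values before to the values after. -/
def ReachPred (M : Machine n S) (B : ℕ) (s s' : S) (x : Fin (n + n) → ℤ)
    (y : AbsEdge M B ⊕ AbsState n S B → ℤ) : Prop :=
  (∀ i, 0 ≤ x i) ∧ (∀ w, 0 ≤ y w) ∧ ∃ a b : AbsState n S B,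
    (a.1 = s ∧ b.1 = s' ∧ b.2.2 = Finset.univ) ∧
    -- Expresses `min (x c) B = a.2.1 c` by linear conditions.
    (∀ c, ((a.2.1 c : ℕ) = B ∧ (B : ℤ) ≤ x (Fin.castAdd n c)) ∨
      x (Fin.castAdd n c) = ((a.2.1 c : ℕ) : ℤ)) ∧
    (∀ q, (∑ e : AbsEdge M B, if e.src = q then y (.inl e) else 0) + (if q = b then 1 else 0) =
      (∑ e : AbsEdge M B, if e.tgt = q then y (.inl e) else 0) + (if q = a then 1 else 0)) ∧
    (∀ q, q = a ∨ (∀ e : AbsEdge M B, ¬ e.src = q ∨ y (.inl e) ≤ 0) ∨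
      ∃ e : AbsEdge M B, e.tgt = q ∧ 0 < y (.inl e) ∧ y (.inr e.src) < y (.inr q)) ∧
    ∀ c, x (Fin.natAdd n c) = (if c ∈ a.2.2 then x (Fin.castAdd n c) else 0) +
      ∑ e : AbsEdge M B, if e.counts c = true then y (.inl e) else 0

theorem cast_flowAt {E Q : Type*} [Fintype E] [DecidableEq Q] (h : E → Q) (f : E → ℕ) (q : Q) :
    (flowAt h f q : ℤ) = ∑ e, if h e = q then (f e : ℤ) else 0 := by
  simp [flowAt]

theorem reachPred_natCast_iff {s s' : S} {w : Fin (n + n) → ℕ} {f : AbsEdge M B → ℕ}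
    {z : AbsState n S B → ℕ} :
    ReachPred M B s s' (fun i => w i) (Sum.elim (fun e => (f e : ℤ)) fun q => (z q : ℤ)) ↔
      ∃ a b : AbsState n S B, (a.1 = s ∧ b.1 = s' ∧ b.2.2 = Finset.univ) ∧
      (∀ c, min (w (Fin.castAdd n c)) B = a.2.1 c) ∧
      (∀ q, flowAt AbsEdge.src f q + (if q = b then 1 else 0) =
        flowAt AbsEdge.tgt f q + (if q = a then 1 else 0)) ∧
      (∀ q, q = a ∨ (∀ e : AbsEdge M B, e.src = q → f e = 0) ∨
        ∃ e : AbsEdge M B, e.tgt = q ∧ 0 < f e ∧ z e.src < z q) ∧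
      ∀ c, w (Fin.natAdd n c) =
        (if c ∈ a.2.2 then w (Fin.castAdd n c) else 0) + flowAt (AbsEdge.counts c) f true := by
  have hnonneg : ∀ w, 0 ≤ Sum.elim (fun e => (f e : ℤ)) (fun q => (z q : ℤ)) w := by
    rintro (e | q) <;> simp
  rw [ReachPred]
  simp only [hnonneg, implies_true, Nat.cast_nonneg, true_and, Sum.elim_inl, Sum.elim_inr,
    ← cast_flowAt]
  refine exists_congr fun a => exists_congr fun b => and_congr_right fun _ =>
    and_congr (forall_congr' fun c => ?_) (and_congr (forall_congr' fun q => ?_)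
      (and_congr (forall_congr' fun q => or_congr_right (or_congr (forall_congr' fun e => ?_)
        (exists_congr fun e => ?_))) (forall_congr' fun c => ?_)))
  · have := (a.2.1 c).isLt
    omega
  · split_ifs <;> omega
  · rw [← imp_iff_not_or]
    exact imp_congr_right fun _ => by omega
  · simp
  · split_ifs <;> omega

/-- The nonnegativity conjuncts let integer solutions be lifted to natural numbers, where
`reach_iff` applies. -/
theorem exists_reachPred_iff (hB : ∀ e ∈ M.edges, 2 ^ e.guard.size ≤ B) {s s' : S}
    {x : Fin (n + n) → ℤ} :
    (∃ y, ReachPred M B s s' x y) ↔ ∃ w ∈ M.reachSet s s', ∀ i, x i = (w i : ℤ) := by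
  have key : ∀ w : Fin (n + n) → ℕ, w ∈ M.reachSet s s' ↔
      ∃ (f : AbsEdge M B → ℕ) (z : AbsState n S B → ℕ), ReachPred M B s s' (fun i => w i)
        (Sum.elim (fun e => (f e : ℤ)) fun q => (z q : ℤ)) := by
    intro w
    simp only [reachPred_natCast_iff]
    rw [← reach_iff hB (v := fun c => w (Fin.castAdd n c)) (v' := fun c => w (Fin.natAdd n c))]
    constructor
    · rintro ⟨v, v', rfl, h⟩
      simpa only [Fin.append_left, Fin.append_right] using h
    · intro h
      exact ⟨_, _, (Fin.append_castAdd_natAdd).symm, h⟩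
  constructor
  · rintro ⟨y, h⟩
    lift x to Fin (n + n) → ℕ using h.1
    lift y to AbsEdge M B ⊕ AbsState n S B → ℕ using h.2.1
    refine ⟨x, (key x).2 ⟨fun e => y (.inl e), fun q => y (.inr q), ?_⟩, fun _ => rfl⟩
    convert h using 1
    funext w
    cases w <;> rfl
  · rintro ⟨w, hw, hx⟩
    obtain rfl : x = fun i => (w i : ℤ) := funext hx
    obtain ⟨f, z, h⟩ := (key w).1 hw
    exact ⟨_, h⟩

/-- The nesting of the constructors does not depend on the machine, so the exponent is an absolute
constant and only the base `T + 8` grows. The choice of `a` and `b` is a finite disjunction rather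
than a quantifier. -/
theorem qfDef_reachPred (s s' : S) {k T : ℕ} (hk : k ≤ T) (hn : n + n ≤ T) (hBT : B ≤ T)
    (hW : Fintype.card (AbsEdge M B) + Fintype.card (AbsState n S B) ≤ T)
    (i : Fin (n + n) → Fin k) (j : AbsEdge M B ⊕ AbsState n S B → Fin k) :
    QFDef T 23 fun x : Fin k → ℤ =>
      ReachPred M B s s' (fun c => x (i c)) (fun w => x (j w)) := by
  have hn₁ : Fintype.card (Fin n) ≤ T := by rw [Fintype.card_fin]; omega
  have hn₂ : Fintype.card (Fin (n + n)) ≤ T := by rwa [Fintype.card_fin]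
  have hE : Fintype.card (AbsEdge M B) ≤ T := by omega
  have hQ : Fintype.card (AbsState n S B) ≤ T := by omega
  have hW' : Fintype.card (AbsEdge M B ⊕ AbsState n S B) ≤ T := by rwa [Fintype.card_sum]
  have h0 : TermDef T 1 fun _ : Fin k → ℤ => 0 := .const (by simp)
  have h1 : TermDef T 1 fun _ : Fin k → ℤ => 1 := .const (by simp)
  have hB : TermDef T 1 fun _ : Fin k → ℤ => (B : ℤ) := .const (by omega)
  have hx := fun c => TermDef.var hk (i c)
  have hy := fun w => TermDef.var hk (j w)
  have hsum : ∀ p : AbsEdge M B → Prop, ∀ _ : DecidablePred p,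
      TermDef T 3 fun x : Fin k → ℤ => ∑ e, if p e then x (j (.inl e)) else 0 :=
    fun p _ => TermDef.sum hE fun e => (hy (.inl e)).ite (p e)
  refine QFDef.mono ((QFDef.forall hn₂ fun c => QFDef.le h0 (hx c)).and
    ((QFDef.forall hW' fun w => QFDef.le h0 (hy w)).and
      (QFDef.exists hQ fun a : AbsState n S B => QFDef.exists hQ fun b : AbsState n S B =>
        (QFDef.prop (a.1 = s ∧ b.1 = s' ∧ b.2.2 = Finset.univ)).and
        ((QFDef.forall hn₁ fun c => ((QFDef.prop ((a.2.1 c : ℕ) = B)).and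
          (QFDef.le hB (hx (Fin.castAdd n c)))).or
            (QFDef.eq (hx (Fin.castAdd n c))
              (TermDef.const (c := ((a.2.1 c : ℕ) : ℤ)) ?_))).and
        ((QFDef.forall hQ fun q : AbsState n S B => QFDef.eq
          ((hsum (fun e => e.src = q) _).add (h1.ite (q = b)))
          ((hsum (fun e => e.tgt = q) _).add (h1.ite (q = a)))).and
        ((QFDef.forall hQ fun q : AbsState n S B => (QFDef.prop (q = a)).or
          ((QFDef.forall hE fun e : AbsEdge M B =>
            (QFDef.prop (¬ e.src = q)).or (QFDef.le (hy (.inl e)) h0)).or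
          (QFDef.exists hE fun e : AbsEdge M B => (QFDef.prop (e.tgt = q)).and
            ((QFDef.lt h0 (hy (.inl e))).and
              (QFDef.lt (hy (.inr e.src)) (hy (.inr q))))))).and
        (QFDef.forall hn₁ fun c => QFDef.eq (hx (Fin.natAdd n c))
          (((hx (Fin.castAdd n c)).ite (c ∈ a.2.2)).add
            (hsum (fun e => e.counts c = true) _))))))))) ?_
  · have := (a.2.1 c).isLt
    omega
  · norm_num

end

/-! ### Exponential bounds on the abstraction -/

theorem Machine.card_edges_le [Fintype S] (M : Machine n S) : M.edges.card ≤ M.size := by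
  have : ∑ _e ∈ M.edges, 1 ≤ ∑ e ∈ M.edges, (3 + e.guard.size) :=
    Finset.sum_le_sum fun e _ => by omega
  rw [Machine.size]
  simp only [Finset.sum_const, smul_eq_mul, mul_one] at this
  omega

theorem Machine.guard_size_le [Fintype S] (M : Machine n S) {e : Edge n S} (he : e ∈ M.edges) :
    e.guard.size ≤ M.size := by
  have := Finset.single_le_sum (f := fun e : Edge n S => 3 + e.guard.size)
    (fun _ _ => Nat.zero_le _) he
  rw [Machine.size]
  omega

/-- With `L = M.size`, the factors are at most `2 ^ L` states, `(2 ^ (L + 1)) ^ L` truncated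
valuations and `2 ^ L` sets of counters. -/
theorem card_absState_le [Fintype S] (M : Machine n S) :
    Fintype.card (AbsState n S (2 ^ M.size)) ≤ 2 ^ (M.size ^ 2 + 3 * M.size) := by
  have hS : Fintype.card S ≤ M.size := by rw [Machine.size]; omega
  have hn : n ≤ M.size := by rw [Machine.size]; omega
  set L := M.size
  have hcard : Fintype.card (AbsState n S (2 ^ L)) =
      Fintype.card S * ((2 ^ L + 1) ^ n * 2 ^ n) := by simp
  have h₁ : 2 ^ L + 1 ≤ 2 ^ (L + 1) := by
    have : 0 < 2 ^ L := by positivity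
    rw [pow_succ]
    omega
  calc Fintype.card (AbsState n S (2 ^ L))
      = Fintype.card S * ((2 ^ L + 1) ^ n * 2 ^ n) := hcard
    _ ≤ 2 ^ L * ((2 ^ (L + 1)) ^ L * 2 ^ L) := by
      refine Nat.mul_le_mul (hS.trans Nat.lt_two_pow_self.le) (Nat.mul_le_mul ?_ ?_)
      · exact (Nat.pow_le_pow_left h₁ n).trans (Nat.pow_le_pow_right (by positivity) hn)
      · exact Nat.pow_le_pow_right (by norm_num) hn
    _ = 2 ^ (L ^ 2 + 3 * L) := by
      rw [← pow_mul, ← pow_add, ← pow_add]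
      congr 1
      ring

theorem card_absEdge_le_pow [Fintype S] (M : Machine n S) :
    Fintype.card (AbsEdge M (2 ^ M.size)) ≤ 2 ^ (2 * M.size ^ 2 + 7 * M.size) := by
  have hQ := card_absState_le M
  have hE : M.edges.card ≤ 2 ^ M.size := M.card_edges_le.trans Nat.lt_two_pow_self.le
  calc Fintype.card (AbsEdge M (2 ^ M.size))
      ≤ _ := card_absEdge_le
    _ ≤ 2 ^ (M.size ^ 2 + 3 * M.size) * (2 ^ M.size * 2 ^ (M.size ^ 2 + 3 * M.size)) := by
      gcongr
    _ = 2 ^ (2 * M.size ^ 2 + 7 * M.size) := by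
      rw [← pow_add, ← pow_add]
      congr 1
      ring

end MonotonicCM

/-! ### The polynomial bound -/

open MonotonicCM PresburgerZ

theorem mainTheorem5 :
    ∃ p : Polynomial ℕ,
      ∀ (n : ℕ) (S : Type*) [Fintype S] (M : MonotonicCM.Machine n S) (s s' : S),
        ∃ φ : PresburgerZ.Formula (n + n),
          φ.IsExistential ∧
          φ.Defines (M.reachSet s s') ∧
          φ.size ≤ 2 ^ p.eval M.size := by
  classical
  -- The factor 25 is the exponent 23 of `qfDef_reachPred` plus 2 for the quantifier block. The
  -- summand 6 arises because `T + 8` is at most `5 * X + 8 ≤ 2 ^ 6 * X`, where `X = 2 ^ (2 * M.size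
  -- ^ 2 + 7 * M.size)`.
  refine ⟨25 * (2 * Polynomial.X ^ 2 + 7 * Polynomial.X + 6), fun n S _ M s s' => ?_⟩
  obtain ⟨B, hB⟩ : ∃ B, B = 2 ^ M.size := ⟨_, rfl⟩
  obtain ⟨T, hT⟩ : ∃ T, T = n + n + B +
    (Fintype.card (AbsEdge M B) + Fintype.card (AbsState n S B)) := ⟨_, rfl⟩
  obtain ⟨φ, h₁, h₂, h₃⟩ := QFDef.exists_formula (T := T)
    (W := AbsEdge M B ⊕ AbsState n S B) (by rw [Fintype.card_sum]; omega)
    (qfDef_reachPred (M := M) (B := B) s s' (by rw [Fintype.card_sum]; omega) (by omega)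
      (by omega) (by omega) (Fin.castAdd _)
      fun w => Fin.natAdd (n + n) (Fintype.equivFin _ w))
  refine ⟨φ, h₁, fun x => (h₃ x).trans (exists_reachPred_iff fun e he => ?_), h₂.trans ?_⟩
  · rw [hB]
    exact Nat.pow_le_pow_right (by omega) (M.guard_size_le he)
  · have hT8 : T + 8 ≤ 2 ^ (2 * M.size ^ 2 + 7 * M.size + 6) := by
      have hn : n ≤ 2 ^ M.size :=
        (by rw [Machine.size]; omega : n ≤ M.size).trans Nat.lt_two_pow_self.le
      have hL : 2 ^ M.size ≤ 2 ^ (2 * M.size ^ 2 + 7 * M.size) :=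
        Nat.pow_le_pow_right (by omega) (by nlinarith)
      have hQ : Fintype.card (AbsState n S B) ≤ 2 ^ (2 * M.size ^ 2 + 7 * M.size) :=
        hB ▸ (card_absState_le M).trans (Nat.pow_le_pow_right (by omega) (by nlinarith))
      have hE : Fintype.card (AbsEdge M B) ≤ 2 ^ (2 * M.size ^ 2 + 7 * M.size) :=
        hB ▸ card_absEdge_le_pow M
      have hpos : 0 < 2 ^ (2 * M.size ^ 2 + 7 * M.size) := by positivity
      rw [pow_add]
      rw [← hB] at hn hL
      omega
    calc (T + 8) ^ (23 + 2) ≤ (2 ^ (2 * M.size ^ 2 + 7 * M.size + 6)) ^ 25 :=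
          Nat.pow_le_pow_left hT8 _
      _ = _ := by
        rw [← pow_mul, mul_comm]
        simp
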